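/- For a finite simple graph $G$ with degree matrix $D(G)$ and adjacency matrix $A(G)$, and $\alpha\in[0,1)$, put $A_\alpha(G)=\alpha D(G)+\beta A(G)$, where $\beta=1-\alpha$. In a rooted tree the level of a vertex is one more than its distance from the root. Let $d\ge 1$, $k\ge 2$, and let $B(d,k)$ be the Bethe tree: the rooted tree with $k$ levels whose root has degree $d$, whose vertices at levels $2,\dots,k-1$ have degree $d+1$, and whose vertices at level $k$ have degree $1$. For $r\ge 3$ let $C_r$ be the cycle on $r$ vertices $v_1,\dots,v_r$, and let $C_r\{B(d,k)\}$ be the graph obtained from $C_r$ and $r$ copies of $B(d,k)$ by identifying the root of the $i$-th copy with $v_i$, $1\le i\le r$. Let $T_k$ be the $k\times k$ symmetric tridiagonal matrix with diagonal $(\alpha,\alpha(d+1),\dots,\alpha(d+1),\alpha d)$ and all codiagonal entries equal to $\beta\sqrt d$. For $1\le j\le k$ let $T_j$ be its leading principal $j\times j$ submatrix. For $1\le i\le r$ let $S_i$ be the matrix obtained from $T_k$ by replacing its last diagonal entry by $$\alpha d+2\alpha+2\beta\cos\frac{2\pi(i-1)}{r}.$$ Then the following hold. (1) As a multiset, with multiplicities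 as in (2), the spectrum of $A_\alpha(C_r\{B(d,k)\})$ is the union of the spectra of $T_1,\dots,T_{k-1}$ and of $S_1,\dots,S_r$. That is, $\mathrm{Spec}(A_\alpha(C_r\{B(d,k)\}))$ is the multiset sum of $r d^{k-j-1}(d-1)$ copies of $\mathrm{Spec}(T_j)$ for each $1\le j\le k-1$ and one copy of $\mathrm{Spec}(S_i)$ for each $1\le i\le r$. In particular, if $d\ge 2$, then as sets $$\mathrm{Spec}(A_\alpha(C_r\{B(d,k)\}))=\Big(\bigcup_{j=1}^{k-1}\mathrm{Spec}(T_j)\Big)\cup\Big(\bigcup_{i=1}^{r}\mathrm{Spec}(S_i)\Big).$$ (2) The eigenvalues of each $T_j$ $(1\le j\le k-1)$ and of each $S_i$ $(1\le i\le r)$ are simple. Each eigenvalue of $T_j$ contributes $r d^{k-j-1}(d-1)$ to its multiplicity as an eigenvalue of $A_\alpha(C_r\{B(d,k)\})$, and each eigenvalue of $S_i$ contributes $1$. If eigenvalues obtained from different matrices are equal, their contributions are added, and the multiplicity of every real number as an eigenvalue of $A_\alpha(C_r\{B(d,k)\})$ is the sum of all these contributions. (3) The spectral radius of $A_\alpha(C_r\{B(d,k)\})$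 is the largest eigenvalue of $S_1$, the matrix obtained from $T_k$ by replacing its last diagonal entry by $\alpha d+2$. -/

import Mathlib

/-- `A_α(G) = α D(G) + (1 - α) A(G)`, with `D(G)` the diagonal matrix of the vertex degrees and
`A(G)` the adjacency matrix of `G`. -/
def alphaMatrix {V : Type*} [Fintype V] [DecidableEq V] (α : ℝ) (G : SimpleGraph V)
    [DecidableRel G.Adj] : Matrix V V ℝ :=
  α • G.degMatrix ℝ + (1 - α) • G.adjMatrix ℝ

/-- The graph `R{H}` obtained from `R` and one copy of the rooted graph `(H, root)` for every vertex
`v` of `R`, by identifying the root of the `v`-th copy with `v`. The vertex `(v, a)` is the vertex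
`a` of the `v`-th copy; in particular `(v, root)` is the vertex `v` of `R`. -/
def copiesGraph {V W : Type*} (R : SimpleGraph V) (H : SimpleGraph W) (root : W) :
    SimpleGraph (V × W) where
  Adj x y := (x.1 = y.1 ∧ H.Adj x.2 y.2) ∨ (R.Adj x.1 y.1 ∧ x.2 = root ∧ y.2 = root)
  symm := ⟨fun x y h => by
    rcases h with ⟨h1, h2⟩ | ⟨h1, h2, h3⟩
    · exact Or.inl ⟨h1.symm, h2.symm⟩
    · exact Or.inr ⟨h1.symm, h3, h2⟩⟩
  loopless := ⟨fun x h => by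
    rcases h with ⟨_, h2⟩ | ⟨h1, _, _⟩
    · exact h2.ne rfl
    · exact h1.ne rfl⟩

instance copiesGraph.decidableAdj {V W : Type*} [DecidableEq V] [DecidableEq W]
    (R : SimpleGraph V) (H : SimpleGraph W) (root : W) [DecidableRel R.Adj] [DecidableRel H.Adj] :
    DecidableRel (copiesGraph R H root).Adj :=
  fun x y => inferInstanceAs (Decidable
    ((x.1 = y.1 ∧ H.Adj x.2 y.2) ∨ (R.Adj x.1 y.1 ∧ x.2 = root ∧ y.2 = root)))

/-- The level of a vertex is one more than its distance from the root. -/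
noncomputable def rootedLevel {W : Type*} (H : SimpleGraph W) (root v : W) : ℕ :=
  H.dist root v + 1

/-- `H`, rooted at `root`, is a Bethe tree `B(d, k)` (for `k ≥ 2`): a rooted tree of `k` levels in
which the root has degree `d`, the vertices at the levels `2, …, k - 1` have degree `d + 1`, and
the vertices at level `k` have degree `1`. -/
structure IsBetheTree {W : Type*} [Fintype W] (H : SimpleGraph W) [DecidableRel H.Adj]
    (root : W) (d k : ℕ) : Prop where
  isTree : H.IsTree
  level_le : ∀ v, rootedLevel H root v ≤ k
  exists_level_eq : ∃ v, rootedLevel H root v = k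
  degree_root : H.degree root = d
  degree_inner : ∀ v, 2 ≤ rootedLevel H root v → rootedLevel H root v ≤ k - 1 →
    H.degree v = d + 1
  degree_leaf : ∀ v, rootedLevel H root v = k → H.degree v = 1

/-- The entry in row `a` and column `b` (counted from `0`) of the `k × k` symmetric tridiagonal
matrix `T_k` (`k ≥ 2`) with diagonal `α, α (d + 1), …, α (d + 1), α d` and all codiagonal entries
equal to `(1 - α) √d`. -/
noncomputable def betheEntry (α : ℝ) (d k a b : ℕ) : ℝ :=
  if a = b then
    if a = 0 then α else if a + 1 = k then α * d else α * (d + 1)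
  else if a + 1 = b ∨ b + 1 = a then (1 - α) * √(d : ℝ)
  else 0

/-- `T_j` (`1 ≤ j ≤ k`): the leading principal `j × j` submatrix of the `k × k` matrix `T_k`. -/
noncomputable def betheT (α : ℝ) (d k j : ℕ) : Matrix (Fin j) (Fin j) ℝ :=
  Matrix.of fun a b => betheEntry α d k a b

/-- The `k × k` matrix `T_k` with `ρ` added to its last diagonal entry, which becomes
`α d + ρ`. -/
noncomputable def betheS (α : ℝ) (d k : ℕ) (ρ : ℝ) : Matrix (Fin k) (Fin k) ℝ :=
  Matrix.of fun a b =>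
    betheEntry α d k a b + if (a : ℕ) + 1 = k ∧ (b : ℕ) + 1 = k then ρ else 0

/-- `2 α + 2 (1 - α) cos (2 π (i - 1) / r)`. -/
noncomputable def cycleRho (α : ℝ) (r i : ℕ) : ℝ :=
  2 * α + 2 * (1 - α) * Real.cos (2 * Real.pi * ((i : ℝ) - 1) / r)

/-- The spectrum of a real symmetric matrix as a multiset: the roots of its characteristic
polynomial, each repeated according to its multiplicity. -/
noncomputable def specMultiset {n : Type*} [Fintype n] [DecidableEq n] (M : Matrix n n ℝ) :
    Multiset ℝ :=
  M.charpoly.roots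

/-! Write β = 1 - α and apply symmetric Gaussian elimination to x - A_α, from the leaves towards the
cycle, for large x. The pivot at a vertex depends only on its level: d children with pivot g
subtract d β² / g from their parent, exactly what one codiagonal entry β√d does in a tridiagonal
matrix. So the pivots g_0, g_1, … are those of x - T_k, with index 0 at the leaves and k - 1 at the
roots. The coupling between the roots is untouched by the elimination, and what remains is g_{k-1} -
A_α(C_r), with determinant ∏ (g_{k-1} - ρ_i) by Fourier analysis on the cycle, where ρ_i is
`cycleRho α r i`.

On the other side det(x - T_j) = g_0 ⋯ g_{j-1} and det(x - S_i) = g_0 ⋯ g_{k-2} (g_{k-1} - ρ_i).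
Since r d^(k-1-a) vertices have pivot g_a, the identity 1 + (d-1) ∑_{a<j<k} d^(k-1-j) = d^(k-1-a)
matches the two products. The characteristic polynomials agree at all large x, hence everywhere
(`IsBetheTree.charpoly_eq`).

Simplicity holds because an eigenvector of a tridiagonal matrix with nonzero codiagonal is
determined by its first coordinate; symmetry turns algebraic multiplicities into geometric ones. For
the spectral radius, S_1 has a positive eigenvector and dominates every T_j and S_i entrywise in
absolute value. -/

namespace Matrix

/-! ### Matrix tools: domination, unipotent congruence, multiplicities, nonnegative eigenvectors. -/

/-- Eigenvalues of a matrix dominated entrywise by a nonnegative matrix with a positive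
eigenvector. -/
theorem abs_eigenvalue_le {m n : Type*} [Fintype m] [Fintype n] {M : Matrix m m ℝ}
    {S : Matrix n n ℝ} {u : n → ℝ} {z : m → ℝ}
    {lam μ : ℝ} (e : m ↪ n) (hMS : ∀ a b, |M a b| ≤ S (e a) (e b)) (hS : ∀ a b, 0 ≤ S a b)
    (hu : ∀ a, 0 < u a) (hSu : S *ᵥ u = lam • u) (hz : z ≠ 0) (hMz : M *ᵥ z = μ • z) :
    |μ| ≤ lam := by
  obtain ⟨a₀, ha₀⟩ := Function.ne_iff.1 hz
  -- With c the maximum of |z| / u, row a, where it is attained, gives |μ| |z a| ≤ c (S u)(e a) =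
  -- lam |z a|.
  obtain ⟨a, -, ha⟩ := Finset.exists_max_image Finset.univ (fun a => |z a| / u (e a))
    ⟨a₀, Finset.mem_univ _⟩
  set c := |z a| / u (e a) with hc
  have hle : ∀ b, |z b| ≤ c * u (e b) := fun b =>
    (div_le_iff₀ (hu _)).1 (ha b (Finset.mem_univ _))
  have hza : |z a| = c * u (e a) := by rw [hc, div_mul_cancel₀ _ (hu _).ne']
  have hcpos : 0 < c := lt_of_lt_of_le (div_pos (abs_pos.2 ha₀) (hu _)) (ha a₀ (Finset.mem_univ _))
  have h1 : |μ| * |z a| ≤ ∑ b, |M a b| * |z b| := by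
    have h := congrFun hMz a
    rw [← abs_mul, show μ * z a = ∑ b, M a b * z b from h.symm]
    simpa only [abs_mul] using Finset.abs_sum_le_sum_abs (fun b => M a b * z b) Finset.univ
  have h2 : ∑ b, |M a b| * |z b| ≤ ∑ b, S (e a) (e b) * (c * u (e b)) :=
    Finset.sum_le_sum fun b _ => mul_le_mul (hMS a b) (hle b) (abs_nonneg _) (hS _ _)
  have h3 : ∑ b, S (e a) (e b) * (c * u (e b)) ≤ ∑ b, S (e a) b * (c * u b) := by
    rw [← Finset.sum_map Finset.univ e fun b => S (e a) b * (c * u b)]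
    exact Finset.sum_le_sum_of_subset_of_nonneg (Finset.subset_univ _) fun b _ _ =>
      mul_nonneg (hS _ _) (mul_nonneg hcpos.le (hu _).le)
  have h4 : ∑ b, S (e a) b * (c * u b) = lam * (c * u (e a)) := by
    have h : ∑ b, S (e a) b * u b = lam * u (e a) := congrFun hSu (e a)
    rw [mul_left_comm, ← h, Finset.mul_sum]
    exact Finset.sum_congr rfl fun b _ => mul_left_comm _ _ _
  rw [← hza] at h4
  exact le_of_mul_le_mul_right (by linarith) (hza ▸ mul_pos hcpos (hu _) : 0 < |z a|)

variable {n : Type*} [Fintype n] [DecidableEq n]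

/-- A perturbation of the identity that strictly raises a level function has determinant `1`. -/
theorem det_one_add_of_strict {R α : Type*} [CommRing R] [LinearOrder α] (b : n → α)
    (N : Matrix n n R) (hN : ∀ i j, b j ≤ b i → N i j = 0) : (1 + N).det = 1 := by
  have hT : (1 + N).BlockTriangular b := by
    intro i j hij
    have hne : i ≠ j := by rintro rfl; exact lt_irrefl _ hij
    simp [hN i j hij.le, one_apply_ne hne]
  rw [hT.det]
  refine Finset.prod_eq_one fun a _ => ?_
  have : (1 + N).toSquareBlock b a = 1 := by
    ext i j
    have h : N i j = 0 := hN _ _ (by rw [i.2, j.2])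
    simp [toSquareBlock_def, h, one_apply, Subtype.ext_iff]
  rw [this, det_one]

theorem det_one_add_mul_mul_transpose {R α : Type*} [CommRing R] [LinearOrder α] (b : n → α)
    (N D : Matrix n n R) (hN : ∀ i j, b j ≤ b i → N i j = 0) :
    ((1 + N) * D * (1 + N)ᵀ).det = D.det := by
  rw [det_mul, det_mul, det_transpose, det_one_add_of_strict b N hN, one_mul, mul_one]

/-- By diagonalization the rank of A - μ counts the eigenvalues different from μ; rank-nullity does
the rest. -/
theorem IsHermitian.finrank_eigenspace_eq_count {A : Matrix n n ℝ} (hA : A.IsHermitian) (μ : ℝ) :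
    Module.finrank ℝ (Module.End.eigenspace (toLin' A) μ) = A.charpoly.roots.count μ := by
  have hrank : (A - algebraMap ℝ _ μ).rank = Fintype.card {i // hA.eigenvalues i - μ ≠ 0} := by
    have h1 : A - algebraMap ℝ _ μ = Unitary.conjStarAlgAut ℝ _ hA.eigenvectorUnitary
        (diagonal fun i => hA.eigenvalues i - μ) := by
      conv_lhs => rw [hA.spectral_theorem]
      have h2 : (diagonal fun i => hA.eigenvalues i - μ) =
          diagonal (RCLike.ofReal ∘ hA.eigenvalues) - algebraMap ℝ (Matrix n n ℝ) μ := by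
        ext i j
        by_cases h : i = j <;> simp [h, algebraMap_matrix_apply]
      rw [h2, map_sub, AlgHomClass.commutes]
    rw [h1, Unitary.conjStarAlgAut_apply, ← rank_diagonal]
    simp [-isUnit_iff_ne_zero, ← Unitary.coe_star,
      rank_mul_eq_left_of_isUnit_det, rank_mul_eq_right_of_isUnit_det]
  have hker : Module.End.eigenspace (toLin' A) μ
      = LinearMap.ker (A - algebraMap ℝ _ μ).mulVecLin := by
    ext v
    simp [Algebra.algebraMap_eq_smul_one, sub_eq_zero]
  have h3 := LinearMap.finrank_range_add_finrank_ker (A - algebraMap ℝ _ μ).mulVecLin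
  rw [← hker] at h3
  change (A - algebraMap ℝ _ μ).rank + _ = _ at h3
  rw [hrank, Module.finrank_fintype_fun_eq_card] at h3
  rw [hA.roots_charpoly_eq_eigenvalues, Multiset.count_map]
  have h4 := Fintype.card_subtype_compl fun i => hA.eigenvalues i - μ = 0
  have h5 := Fintype.card_subtype_le fun i => hA.eigenvalues i - μ = 0
  have h6 : Fintype.card {i // hA.eigenvalues i - μ = 0} =
      (Multiset.filter (fun i => μ = hA.eigenvalues i) Finset.univ.val).card := by
    rw [Fintype.card_subtype]
    simp only [sub_eq_zero, eq_comm (a := μ)]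
    rfl
  simp only [RCLike.ofReal_real_eq_id, Function.comp_apply, id_eq]
  simp only [ne_eq] at h3
  omega

theorem exists_mulVec_eq_smul_of_mem_spectrum {K : Type*} [Field K] {A : Matrix n n K} {μ : K}
    (h : μ ∈ spectrum K A) : ∃ z, z ≠ 0 ∧ A *ᵥ z = μ • z := by
  rw [← spectrum_toLin', ← Module.End.hasEigenvalue_iff_mem_spectrum] at h
  obtain ⟨z, hz⟩ := h.exists_hasEigenvector
  exact ⟨z, hz.2, by simpa using hz.apply_eq_smul⟩

/-- A real symmetric matrix with nonnegative entries has a nonnegative eigenvector for an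
eigenvalue that is maximal in its spectrum. -/
theorem IsHermitian.exists_nonneg_eigenvector [Nonempty n] {S : Matrix n n ℝ}
    (hS : S.IsHermitian) (hS0 : ∀ a b, 0 ≤ S a b) :
    ∃ lam ∈ spectrum ℝ S, ∃ u : n → ℝ, u ≠ 0 ∧ (∀ a, 0 ≤ u a) ∧ S *ᵥ u = lam • u := by
  have hspec : (spectrum ℝ S).Nonempty := by
    rw [hS.spectrum_real_eq_range_eigenvalues]; exact Set.range_nonempty _
  have hfin : (spectrum ℝ S).Finite := finite_real_spectrum
  obtain ⟨lam, hlam, hmax⟩ := hfin.exists_maximal hspec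
  have hmax' : ∀ μ ∈ spectrum ℝ S, μ ≤ lam := fun μ hμ => by
    rcases le_total μ lam with h | h
    · exact h
    · exact hmax hμ h
  obtain ⟨z, hz, hSz⟩ := exists_mulVec_eq_smul_of_mem_spectrum hlam
  have hpsd : (algebraMap ℝ (Matrix n n ℝ) lam - S).PosSemidef := by
    rw [posSemidef_iff_isHermitian_and_spectrum_nonneg]
    refine ⟨?_, ?_⟩
    · refine IsHermitian.sub ?_ hS
      ext i j
      simp [algebraMap_matrix_apply, eq_comm]
    · intro μ hμ
      rw [← spectrum.singleton_sub_eq] at hμ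
      obtain ⟨_, rfl, ν, hν, rfl⟩ := hμ
      exact sub_nonneg.2 (hmax' ν hν)
  refine ⟨lam, hlam, fun a => |z a|, fun h => hz (funext fun a => by simpa using congrFun h a),
    fun a => abs_nonneg _, ?_⟩
  have hmv : ∀ w : n → ℝ, (algebraMap ℝ (Matrix n n ℝ) lam - S) *ᵥ w = lam • w - S *ᵥ w := by
    intro w
    simp [sub_mulVec, Algebra.algebraMap_eq_smul_one, smul_mulVec]
  -- As S ≥ 0 entrywise, replacing z by |z| cannot increase the form of lam - S, which vanishes at
  -- z. A zero of a positive semidefinite form lies in the kernel.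
  have hzero : (algebraMap ℝ (Matrix n n ℝ) lam - S) *ᵥ (fun a => |z a|) = 0 := by
    rw [← hpsd.dotProduct_mulVec_zero_iff]
    refine le_antisymm ?_ (hpsd.dotProduct_mulVec_nonneg _)
    have h0 : z ⬝ᵥ ((algebraMap ℝ (Matrix n n ℝ) lam - S) *ᵥ z) = 0 := by
      rw [hmv, hSz, sub_self, dotProduct_zero]
    rw [← h0, hmv, hmv, dotProduct_sub, dotProduct_sub]
    have e1 : star (fun a => |z a|) ⬝ᵥ lam • (fun a => |z a|) = z ⬝ᵥ lam • z := by
      simp only [dotProduct, star_trivial, Pi.smul_apply, smul_eq_mul]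
      refine Finset.sum_congr rfl fun a _ => ?_
      rw [mul_left_comm, abs_mul_abs_self, mul_left_comm]
    rw [e1]
    refine sub_le_sub_left ?_ _
    simp only [dotProduct, mulVec, star_trivial, Finset.mul_sum]
    refine Finset.sum_le_sum fun a _ => Finset.sum_le_sum fun b _ => ?_
    calc z a * (S a b * z b) ≤ |z a * (S a b * z b)| := le_abs_self _
      _ = |z a| * (S a b * |z b|) := by rw [abs_mul, abs_mul, abs_of_nonneg (hS0 a b)]
  rw [hmv, sub_eq_zero] at hzero
  exact hzero.symm

end Matrix

/-! ### Jacobi matrices: simple spectrum, positive eigenvectors, pivots. -/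

/-- The symmetric tridiagonal matrix with diagonal `c 0, c 1, …` and codiagonal entries `e`. -/
def jacobiMatrix (c : ℕ → ℝ) (e : ℝ) (j : ℕ) : Matrix (Fin j) (Fin j) ℝ :=
  Matrix.of fun a b =>
    if (a : ℕ) = b then c a else if (a : ℕ) + 1 = b ∨ (b : ℕ) + 1 = a then e else 0

namespace jacobiMatrix

open Matrix

variable {c : ℕ → ℝ} {e : ℝ} {j : ℕ}

theorem isHermitian : (jacobiMatrix c e j).IsHermitian := by
  ext a b
  simp only [jacobiMatrix, conjTranspose_apply, of_apply, star_trivial]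
  grind

/-- Three-term recurrence: since e ≠ 0, row n determines coordinate n + 1 from the earlier ones. -/
theorem eq_zero_of_zero_eq_zero (he : e ≠ 0) {z : Fin (j + 1) → ℝ} {μ : ℝ}
    (hz : jacobiMatrix c e (j + 1) *ᵥ z = μ • z) (h0 : z 0 = 0) : z = 0 := by
  have key : ∀ n, ∀ a : Fin (j + 1), (a : ℕ) ≤ n → z a = 0 := by
    intro n
    induction n with
    | zero =>
      intro a ha
      rwa [show a = 0 from Fin.ext (by simpa using ha)]
    | succ n ih =>
      intro a ha
      rcases Nat.lt_or_ge (a : ℕ) (n + 1) with h | h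
      · exact ih a (by omega)
      have han : (a : ℕ) = n + 1 := le_antisymm ha h
      let p : Fin (j + 1) := ⟨n, by omega⟩
      have hrow : ∑ b, jacobiMatrix c e (j + 1) p b * z b = μ * z p := congrFun hz p
      rw [ih p le_rfl, mul_zero, Finset.sum_eq_single a] at hrow
      · have : jacobiMatrix c e (j + 1) p a = e := by
          simp [jacobiMatrix, p, han]
        rw [this] at hrow
        exact (mul_eq_zero.1 hrow).resolve_left he
      · intro b _ hb
        rcases Nat.lt_or_ge n (b : ℕ) with h' | h'
        · have : jacobiMatrix c e (j + 1) p b = 0 := by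
            have hb' : (b : ℕ) ≠ a := fun h => hb (Fin.ext h)
            simp only [jacobiMatrix, of_apply, p]
            rw [if_neg (by omega), if_neg (by omega)]
          rw [this, zero_mul]
        · rw [ih b h', mul_zero]
      · simp
  exact funext fun a => key a a le_rfl

theorem finrank_eigenspace_le_one (he : e ≠ 0) (μ : ℝ) :
    Module.finrank ℝ (Module.End.eigenspace (toLin' (jacobiMatrix c e j)) μ) ≤ 1 := by
  cases j with
  | zero =>
    refine (Submodule.finrank_le _).trans ?_
    simp
  | succ j =>
    have h := LinearMap.finrank_le_finrank_of_injective
      (f := (LinearMap.proj (R := ℝ) (φ := fun _ : Fin (j + 1) => ℝ) 0).comp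
        (Module.End.eigenspace (toLin' (jacobiMatrix c e (j + 1))) μ).subtype) ?_
    · simpa using h
    · rw [injective_iff_map_eq_zero]
      rintro ⟨z, hz⟩ h0
      rw [Module.End.mem_eigenspace_iff, toLin'_apply] at hz
      exact Subtype.ext (eq_zero_of_zero_eq_zero he hz h0)

theorem nodup_roots_charpoly (he : e ≠ 0) : (jacobiMatrix c e j).charpoly.roots.Nodup := by
  rw [Multiset.nodup_iff_count_le_one]
  intro μ
  rw [← isHermitian.finrank_eigenspace_eq_count]
  exact finrank_eigenspace_le_one he μ

/-- A zero coordinate makes its row a vanishing sum of nonnegative terms, so the preceding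
coordinate vanishes too. Descending to coordinate 0 forces u = 0. -/
theorem pos_of_nonneg (he : 0 < e) (hc : ∀ a, 0 ≤ c a) {u : Fin (j + 1) → ℝ} {lam : ℝ}
    (hu : jacobiMatrix c e (j + 1) *ᵥ u = lam • u) (hu0 : ∀ a, 0 ≤ u a) (hne : u ≠ 0)
    (a : Fin (j + 1)) : 0 < u a := by
  refine (hu0 a).lt_of_ne fun h => hne (eq_zero_of_zero_eq_zero he.ne' hu ?_)
  have key : ∀ n, ∀ a : Fin (j + 1), (a : ℕ) = n → u a = 0 → u 0 = 0 := by
    intro n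
    induction n with
    | zero =>
      intro a ha h
      rwa [show a = 0 from Fin.ext (by simpa using ha)] at h
    | succ n ih =>
      intro a ha h
      let p : Fin (j + 1) := ⟨n, by omega⟩
      refine ih p rfl ?_
      have hrow : ∑ b, jacobiMatrix c e (j + 1) a b * u b = lam * u a := congrFun hu a
      rw [h, mul_zero, Finset.sum_eq_zero_iff_of_nonneg] at hrow
      · have := hrow p (Finset.mem_univ _)
        have hap : jacobiMatrix c e (j + 1) a p = e := by
          simp [jacobiMatrix, p, ha]
        rw [hap] at this
        exact (mul_eq_zero.1 this).resolve_left he.ne'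
      · intro b _
        refine mul_nonneg ?_ (hu0 b)
        simp only [jacobiMatrix, of_apply]
        split_ifs
        exacts [hc _, he.le, le_rfl]
  exact key a a rfl h.symm

/-- This is the LDLᵀ factorization with pivots g. The last pivot may vanish, since nothing is
divided by it. -/
theorem det_scalar_sub {g : ℕ → ℝ} (x : ℝ) (h0 : g 0 = x - c 0)
    (hg : ∀ a, a + 1 < j → g a ≠ 0 ∧ g (a + 1) = x - c (a + 1) - e ^ 2 / g a) :
    (scalar (Fin j) x - jacobiMatrix c e j).det = ∏ a : Fin j, g a := by
  let N : Matrix (Fin j) (Fin j) ℝ := of fun a b => if (b : ℕ) + 1 = a then -e / g b else 0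
  -- N is strictly lower triangular, so the level function that it raises is the index in the
  -- reversed order.
  have hN : ∀ a b : Fin j, OrderDual.toDual b ≤ OrderDual.toDual a → N a b = 0 := by
    intro a b hab
    have hab' : (a : ℕ) ≤ b := hab
    simp only [N, of_apply]
    rw [if_neg (by omega)]
  have key : scalar (Fin j) x - jacobiMatrix c e j =
      (1 + N) * diagonal (fun a : Fin j => g a) * (1 + N)ᵀ := by
    have hexp : (1 + N) * diagonal (fun a : Fin j => g a) * (1 + N)ᵀ =
        diagonal (fun a : Fin j => g a) + N * diagonal (fun a : Fin j => g a) +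
          diagonal (fun a : Fin j => g a) * Nᵀ + N * diagonal (fun a : Fin j => g a) * Nᵀ := by
      rw [transpose_add, transpose_one]
      noncomm_ring
    rw [hexp]
    have hsum : ∀ a b : Fin j, (N * diagonal (fun a : Fin j => g a) * Nᵀ) a b =
        if a = b ∧ 0 < (a : ℕ) then e ^ 2 / g (a - 1) else 0 := by
      intro a b
      rw [mul_apply]
      simp only [mul_diagonal, transpose_apply]
      by_cases ha : 0 < (a : ℕ)
      · let p : Fin j := ⟨a - 1, by omega⟩
        have hp : (p : ℕ) + 1 = a := Nat.sub_add_cancel ha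
        rw [Finset.sum_eq_single p]
        · have hgp := (hg p (by omega)).1
          by_cases hab : a = b
          · subst hab
            rw [if_pos ⟨rfl, ha⟩]
            simp only [N, of_apply, if_pos hp]
            change _ = e ^ 2 / g p
            field_simp
          · rw [if_neg (by simp [hab])]
            have : N b p = 0 := by
              simp only [N, of_apply]
              rw [if_neg fun h => hab (Fin.ext (hp.symm.trans h))]
            rw [this, mul_zero]
        · intro q _ hq
          have : N a q = 0 := by
            simp only [N, of_apply]
            rw [if_neg fun h => hq (Fin.ext (by omega))]
          rw [this, zero_mul, zero_mul]
        · simp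
      · rw [if_neg (by simp [ha])]
        refine Finset.sum_eq_zero fun q _ => ?_
        have : N a q = 0 := by
          simp only [N, of_apply]
          rw [if_neg (by omega)]
        rw [this, zero_mul, zero_mul]
    ext a b
    rw [Matrix.add_apply, Matrix.add_apply, Matrix.add_apply, hsum, mul_diagonal, diagonal_mul, transpose_apply]
    simp only [N, jacobiMatrix, Matrix.sub_apply, scalar_apply, diagonal_apply, of_apply, Fin.ext_iff]
    rcases lt_trichotomy (a : ℕ) b with h | h | h
    · have e1 : ¬ (a : ℕ) = b := by omega
      have e2 : ¬ (b : ℕ) + 1 = a := by omega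
      simp only [e1, e2, if_false, false_and, or_false]
      by_cases h' : (a : ℕ) + 1 = b
      · have := (hg a (by omega)).1
        simp only [h', if_true]
        field_simp
        ring
      · simp only [h', if_false]
        ring
    · obtain rfl : a = b := Fin.ext h
      simp only [if_true, true_and]
      rw [if_neg (by omega)]
      by_cases ha : 0 < (a : ℕ)
      · rw [if_pos ha]
        obtain ⟨p, hp⟩ : ∃ p, (a : ℕ) = p + 1 := ⟨a - 1, by omega⟩
        rw [hp, (hg p (hp ▸ a.2)).2]
        simp
      · have ha' : (a : ℕ) = 0 := by omega
        rw [if_neg ha, ha', h0]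
        simp
    · have e1 : ¬ (a : ℕ) = b := by omega
      have e2 : ¬ (a : ℕ) + 1 = b := by omega
      simp only [e1, e2, if_false, false_and, false_or]
      by_cases h' : (b : ℕ) + 1 = a
      · have := (hg b (by omega)).1
        simp only [h', if_true]
        field_simp
        ring
      · simp only [h', if_false]
        ring
  rw [key, det_one_add_mul_mul_transpose (fun a : Fin j => OrderDual.toDual a) N _ hN,
    det_diagonal]

end jacobiMatrix

/-! ### Parents and children in a rooted tree. -/

namespace SimpleGraph.IsTree

variable {W : Type*} {H : SimpleGraph W}

/-- In a tree, a vertex other than the root has exactly one neighbour closer to the root. -/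
theorem existsUnique_adj_dist_add_one (hH : H.IsTree) {root v : W} (hv : v ≠ root) :
    ∃! w, H.Adj v w ∧ H.dist root w + 1 = H.dist root v := by
  obtain ⟨p, hp⟩ := hH.connected.exists_walk_length_eq_dist root v
  have hnil : ¬ p.Nil := fun h => hv h.eq.symm
  have hadj := p.adj_penultimate hnil
  refine ⟨p.penultimate, ⟨hadj.symm, ?_⟩, ?_⟩
  · have h1 : H.dist root p.penultimate ≤ p.length - 1 := by
      simpa using dist_le p.dropLast
    have h2 : 0 < p.length := by
      rcases Nat.eq_zero_or_pos p.length with h | h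
      · exact absurd (Walk.length_eq_zero_iff.1 h) hnil
      · exact h
    rcases hH.dist_eq_dist_add_one_of_adj root hadj with h | h <;> omega
  -- Extending a geodesic to w by v gives a path to v; paths in a tree are unique, so w is
  -- penultimate on p.
  · rintro w ⟨hw, hd⟩
    obtain ⟨q, hq⟩ := hH.connected.exists_walk_length_eq_dist root w
    have hq' : (q.concat hw.symm).length = H.dist root v := by rw [Walk.length_concat]; omega
    have := hH.isAcyclic.subsingleton_path root v |>.elim
      ⟨p, p.isPath_of_length_eq_dist hp⟩ ⟨_, Walk.isPath_of_length_eq_dist _ hq'⟩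
    rw [Subtype.mk.injEq] at this
    rw [this, Walk.penultimate_concat]

variable [Fintype W] [DecidableRel H.Adj]

theorem card_parents (hH : H.IsTree) {root v : W} (hv : v ≠ root) :
    (Finset.univ.filter fun w => H.Adj v w ∧ H.dist root w + 1 = H.dist root v).card = 1 := by
  obtain ⟨w, hw, huniq⟩ := hH.existsUnique_adj_dist_add_one hv
  rw [Finset.card_eq_one]
  refine ⟨w, Finset.ext fun u => ?_⟩
  simp only [Finset.mem_filter, Finset.mem_univ, true_and, Finset.mem_singleton]
  exact ⟨huniq u, fun h => h ▸ hw⟩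

variable [DecidableEq W] in
theorem card_parents_add_card_children (hH : H.IsTree) (root v : W) :
    (Finset.univ.filter fun w => H.Adj v w ∧ H.dist root w + 1 = H.dist root v).card +
      (Finset.univ.filter fun w => H.Adj v w ∧ H.dist root w = H.dist root v + 1).card =
        H.degree v := by
  rw [← Finset.card_union_of_disjoint, ← card_neighborFinset_eq_degree]
  · congr 1
    ext w
    simp only [Finset.mem_union, Finset.mem_filter, Finset.mem_univ, true_and, mem_neighborFinset]
    constructor
    · rintro (h | h) <;> exact h.1
    · intro h
      rcases hH.dist_eq_dist_add_one_of_adj root h with h' | h'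
      · exact Or.inl ⟨h, h'.symm⟩
      · exact Or.inr ⟨h, h'⟩
  · rw [Finset.disjoint_filter]
    rintro w - ⟨_, h1⟩ ⟨_, h2⟩
    omega

end SimpleGraph.IsTree

/-! ### Bethe trees: level sizes and elimination towards the root. -/

namespace IsBetheTree

open Matrix

variable {W : Type*} [Fintype W] {H : SimpleGraph W} [DecidableRel H.Adj]
  {root : W} {d k : ℕ}

theorem dist_lt (hH : IsBetheTree H root d k) (v : W) : H.dist root v < k :=
  hH.level_le v

theorem dist_eq_zero_iff (hH : IsBetheTree H root d k) {v : W} : H.dist root v = 0 ↔ v = root := by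
  rw [hH.isTree.connected.dist_eq_zero_iff, eq_comm]

variable [DecidableEq W]

theorem card_children (hH : IsBetheTree H root d k) (hk : 2 ≤ k) (v : W) :
    (Finset.univ.filter fun w => H.Adj v w ∧ H.dist root w = H.dist root v + 1).card =
      if H.dist root v + 1 = k then 0 else d := by
  have hsum := hH.isTree.card_parents_add_card_children root v
  by_cases hv : v = root
  · subst hv
    have h0 : H.dist v v = 0 := SimpleGraph.dist_self
    rw [if_neg (by omega)]
    have : (Finset.univ.filter fun w => H.Adj v w ∧ H.dist v w + 1 = H.dist v v) = ∅ := by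
      rw [Finset.filter_eq_empty_iff]
      rintro w - ⟨_, h⟩
      omega
    rw [this, hH.degree_root, Finset.card_empty, zero_add] at hsum
    exact hsum
  · have hpos : H.dist root v ≠ 0 := fun h => hv (hH.dist_eq_zero_iff.1 h)
    rw [hH.isTree.card_parents hv] at hsum
    split_ifs with h
    · rw [hH.degree_leaf v h] at hsum
      omega
    · have := hH.dist_lt v
      rw [hH.degree_inner v (by simp only [rootedLevel]; omega)
        (by simp only [rootedLevel]; omega)] at hsum
      omega

theorem card_level (hH : IsBetheTree H root d k) (hk : 2 ≤ k) (l : ℕ) (hl : l < k) :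
    (Finset.univ.filter fun w => H.dist root w = l).card = d ^ l := by
  induction l with
  | zero =>
    rw [pow_zero, Finset.card_eq_one]
    exact ⟨root, Finset.ext fun w => by simp [hH.dist_eq_zero_iff]⟩
  | succ l ih =>
    rw [pow_succ, ← ih (by omega), ← mul_one (Finset.card _)]
    symm
    -- Double count the edges between consecutive levels: d children above, one parent below.
    refine Finset.card_mul_eq_card_mul H.Adj ?_ ?_
    · intro v hv
      have hv' : H.dist root v = l := by simpa using hv
      have := hH.card_children hk v
      rw [if_neg (by omega), hv'] at this
      rw [← this, Finset.bipartiteAbove, Finset.filter_filter]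
      simp only [and_comm]
    · intro v hv
      have hv' : H.dist root v = l + 1 := by simpa using hv
      have hne : v ≠ root := fun h => by
        rw [hH.dist_eq_zero_iff.2 h] at hv'
        omega
      have := hH.isTree.card_parents hne
      rw [hv'] at this
      rw [← this, Finset.bipartiteBelow, Finset.filter_filter]
      refine congrArg _ (Finset.filter_congr fun w _ => ?_)
      rw [H.adj_comm, add_left_inj, and_comm]

theorem prod_dist (hH : IsBetheTree H root d k) (hk : 2 ≤ k) {M : Type*} [CommMonoid M]
    (F : ℕ → M) : ∏ w ∈ Finset.univ.erase root, F (H.dist root w) =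
      ∏ l ∈ Finset.Ico 1 k, F l ^ d ^ l := by
  have hmap : ∀ w ∈ Finset.univ.erase root, H.dist root w ∈ Finset.Ico 1 k := by
    intro w hw
    have h1 : H.dist root w ≠ 0 := fun h => (Finset.mem_erase.1 hw).1 (hH.dist_eq_zero_iff.1 h)
    exact Finset.mem_Ico.2 ⟨Nat.one_le_iff_ne_zero.2 h1, hH.dist_lt w⟩
  rw [← Finset.prod_fiberwise_of_maps_to hmap]
  refine Finset.prod_congr rfl fun l hl => ?_
  obtain ⟨hl1, hl2⟩ := Finset.mem_Ico.1 hl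
  rw [Finset.prod_congr rfl (g := fun _ => F l) fun w hw => by rw [(Finset.mem_filter.1 hw).2],
    Finset.prod_const, ← hH.card_level hk l hl2]
  congr 2
  ext w
  simp only [Finset.mem_filter, Finset.mem_erase, Finset.mem_univ, and_true, true_and,
    and_iff_right_iff_imp]
  rintro h rfl
  rw [SimpleGraph.dist_self] at h
  omega

/-- Tridiagonal indices run from the leaves (0) to the root (k - 1), hence the reversal k - 1 -
dist. -/
theorem mul_degree_eq (hH : IsBetheTree H root d k) (hk : 2 ≤ k) (α : ℝ) (v : W) :
    α * H.degree v = betheEntry α d k (k - 1 - H.dist root v) (k - 1 - H.dist root v) := by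
  have hlt := hH.dist_lt v
  rw [betheEntry, if_pos rfl]
  by_cases h1 : H.dist root v + 1 = k
  · rw [if_pos (by omega), hH.degree_leaf v h1]
    simp
  · rw [if_neg (by omega)]
    by_cases h2 : v = root
    · have h0 := hH.dist_eq_zero_iff.2 h2
      rw [if_pos (by omega), h2, hH.degree_root]
    · have h0 : H.dist root v ≠ 0 := fun h => h2 (hH.dist_eq_zero_iff.1 h)
      rw [if_neg (by omega), hH.degree_inner v (by simp only [rootedLevel]; omega)
        (by simp only [rootedLevel]; omega)]
      push_cast
      rfl

/-- The pivots of the tridiagonal matrix also eliminate the matrix of the tree from the leaves to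
the root. -/
theorem exists_factorization (hH : IsBetheTree H root d k) (hk : 2 ≤ k) (α x : ℝ) {g : ℕ → ℝ}
    (h0 : g 0 = x - betheEntry α d k 0 0)
    (hg : ∀ a, a + 1 < k → g a ≠ 0 ∧
      g (a + 1) = x - betheEntry α d k (a + 1) (a + 1) - d * (1 - α) ^ 2 / g a) :
    ∃ N : Matrix W W ℝ, (∀ v w, H.dist root w ≤ H.dist root v → N v w = 0) ∧
      scalar W x - alphaMatrix α H =
        (1 + N) * diagonal (fun w => g (k - 1 - H.dist root w)) * (1 + N)ᵀ := by
  set D : Matrix W W ℝ := diagonal (fun w => g (k - 1 - H.dist root w)) with hD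
  let N : Matrix W W ℝ := of fun v w =>
    if H.Adj v w ∧ H.dist root w = H.dist root v + 1 then
      -(1 - α) / g (k - 1 - H.dist root w) else 0
  have hgne : ∀ w, H.dist root w ≠ 0 → g (k - 1 - H.dist root w) ≠ 0 := fun w hw =>
    (hg _ (by have := hH.dist_lt w; omega)).1
  refine ⟨N, fun v w h => if_neg (by omega), ?_⟩
  have hND : ∀ v w, (N * D) v w =
      if H.Adj v w ∧ H.dist root w = H.dist root v + 1 then -(1 - α) else 0 := by
    intro v w
    rw [hD, mul_diagonal]
    simp only [N, of_apply]
    split_ifs with h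
    · exact div_mul_cancel₀ _ (hgne w (by omega))
    · exact zero_mul _
  -- Off the diagonal a nonzero term would need a common child, contradicting uniqueness of the
  -- parent; on the diagonal each of the d children contributes equally.
  have hNDN : ∀ v w, (N * D * Nᵀ) v w = if v = w ∧ H.dist root v + 1 ≠ k then
      d * (1 - α) ^ 2 / g (k - 1 - (H.dist root v + 1)) else 0 := by
    intro v w
    rw [mul_apply]
    simp only [hND, transpose_apply, N, of_apply]
    by_cases hvw : v = w
    · subst hvw
      have : ∀ u, ((if H.Adj v u ∧ H.dist root u = H.dist root v + 1 then -(1 - α) else 0) *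
          if H.Adj v u ∧ H.dist root u = H.dist root v + 1 then
            -(1 - α) / g (k - 1 - H.dist root u) else 0) =
          if H.Adj v u ∧ H.dist root u = H.dist root v + 1 then
            (1 - α) ^ 2 / g (k - 1 - (H.dist root v + 1)) else 0 := by
        intro u
        split_ifs with h
        · rw [h.2]
          ring
        · ring
      simp only [this]
      rw [← Finset.sum_filter, Finset.sum_const, hH.card_children hk, nsmul_eq_mul]
      by_cases hv : H.dist root v + 1 = k
      · simp [hv]
      · simp only [hv, if_false, ne_eq, not_false_eq_true, and_self, if_true]
        ring
    · rw [if_neg (by simp [hvw])]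
      refine Finset.sum_eq_zero fun u _ => ?_
      by_contra hne
      have h1 : H.Adj v u ∧ H.dist root u = H.dist root v + 1 := by
        by_contra h
        simp [h] at hne
      have h2 : H.Adj w u ∧ H.dist root u = H.dist root w + 1 := by
        by_contra h
        simp [h] at hne
      have hu : u ≠ root := fun h => by
        have := hH.dist_eq_zero_iff.2 h
        omega
      exact hvw ((hH.isTree.existsUnique_adj_dist_add_one hu).unique ⟨h1.1.symm, h1.2.symm⟩
        ⟨h2.1.symm, h2.2.symm⟩)
  have hexp : (1 + N) * D * (1 + N)ᵀ = D + N * D + (N * D)ᵀ + N * D * Nᵀ := by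
    rw [transpose_add, transpose_one, transpose_mul, hD, diagonal_transpose]
    noncomm_ring
  rw [hexp]
  ext v w
  rw [Matrix.add_apply, Matrix.add_apply, Matrix.add_apply, hNDN, transpose_apply, hND, hND, hD]
  simp only [alphaMatrix, Matrix.sub_apply, scalar_apply, diagonal_apply, Matrix.add_apply,
    Matrix.smul_apply, SimpleGraph.degMatrix, SimpleGraph.adjMatrix_apply, smul_eq_mul]
  by_cases hvw : v = w
  · subst hvw
    simp only [if_true, true_and, H.irrefl, false_and, if_false, add_zero, mul_zero]
    rw [hH.mul_degree_eq hk]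
    have hlt := hH.dist_lt v
    by_cases hv : H.dist root v + 1 = k
    · rw [if_neg (not_not.2 hv), show k - 1 - H.dist root v = 0 by omega, h0, add_zero]
    · rw [if_pos hv]
      obtain ⟨a, ha⟩ : ∃ a, k - 1 - H.dist root v = a + 1 := ⟨k - 1 - H.dist root v - 1, by omega⟩
      rw [show k - 1 - (H.dist root v + 1) = a by omega, ha, (hg a (by omega)).2]
      ring
  · simp only [hvw, if_false, false_and]
    by_cases hadj : H.Adj v w
    · rcases hH.isTree.dist_eq_dist_add_one_of_adj root hadj with h | h
      · rw [if_pos hadj, if_neg (by omega), if_pos ⟨hadj.symm, h⟩]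
        ring
      · rw [if_pos hadj, if_pos ⟨hadj, h⟩, if_neg (by omega)]
        ring
    · rw [if_neg hadj, if_neg (fun h => hadj h.1), if_neg (fun h => hadj h.1.symm)]
      ring

end IsBetheTree

/-! ### Attaching copies of a rooted graph along their roots. -/

open scoped Kronecker in
/-- The `A_α`-matrix of `R{H}` in Kronecker form. -/
theorem alphaMatrix_copiesGraph {V W : Type*} [Fintype V] [DecidableEq V] [Fintype W]
    [DecidableEq W] (α : ℝ) (R : SimpleGraph V) (H : SimpleGraph W) (root : W)
    [DecidableRel R.Adj] [DecidableRel H.Adj] :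
    alphaMatrix α (copiesGraph R H root) =
      (1 : Matrix V V ℝ) ⊗ₖ alphaMatrix α H + alphaMatrix α R ⊗ₖ Matrix.single root root 1 := by
  have hadj : ∀ (i j : V) (v w : W),
      (if (copiesGraph R H root).Adj (i, v) (j, w) then (1 : ℝ) else 0) =
        (if i = j then if H.Adj v w then 1 else 0 else 0) +
          if R.Adj i j then if root = v ∧ root = w then 1 else 0 else 0 := by
    intro i j v w
    change (if (i = j ∧ H.Adj v w) ∨ (R.Adj i j ∧ v = root ∧ w = root) then (1 : ℝ) else 0) = _
    by_cases hij : i = j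
    · subst hij
      simp
    · simp [hij, eq_comm (a := root), ← ite_and]
  have hdeg : ∀ (i : V) (v : W), ((copiesGraph R H root).degree (i, v) : ℝ) =
      H.degree v + if root = v then (R.degree i : ℝ) else 0 := by
    intro i v
    rw [SimpleGraph.degree_eq_sum_if_adj, SimpleGraph.degree_eq_sum_if_adj,
      SimpleGraph.degree_eq_sum_if_adj, Fintype.sum_prod_type]
    simp only [hadj, Finset.sum_add_distrib]
    congr 1
    · rw [Finset.sum_comm]
      simp
    · by_cases hv : root = v
      · simp only [hv, true_and, if_true]
        refine Finset.sum_congr rfl fun j _ => ?_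
        split_ifs <;> simp
      · simp [hv]
  ext ⟨i, v⟩ ⟨j, w⟩
  simp only [alphaMatrix, Matrix.add_apply, Matrix.smul_apply, Matrix.kroneckerMap_apply,
    SimpleGraph.degMatrix, Matrix.diagonal_apply, SimpleGraph.adjMatrix_apply, smul_eq_mul, hadj,
    hdeg, Matrix.single_apply, Matrix.one_apply, Prod.mk.injEq]
  by_cases hij : i = j <;> by_cases hvw : v = w <;> by_cases hv : root = v <;>
    simp_all <;> ring

open scoped Kronecker in
/-- The determinant for `R{H}` when `H` can be eliminated towards its root. -/
theorem det_scalar_sub_alphaMatrix_copiesGraph {V W : Type*} [Fintype V] [DecidableEq V]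
    [Fintype W] [DecidableEq W] (α x : ℝ) (R : SimpleGraph V) (H : SimpleGraph W) (root : W)
    [DecidableRel R.Adj] [DecidableRel H.Adj] (b : W → ℕ) (hb : b root = 0)
    (N : Matrix W W ℝ) (Δ : W → ℝ) (hN : ∀ v w, b w ≤ b v → N v w = 0)
    (hH : Matrix.scalar W x - alphaMatrix α H =
      (1 + N) * Matrix.diagonal Δ * (1 + N).transpose) :
    (Matrix.scalar (V × W) x - alphaMatrix α (copiesGraph R H root)).det =
      (∏ w ∈ Finset.univ.erase root, Δ w ^ Fintype.card V) *
        (Matrix.scalar V (Δ root) - alphaMatrix α R).det := by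
  set C := alphaMatrix α R
  set E : Matrix W W ℝ := Matrix.single root root 1 with hE
  -- The root has the lowest level, so its column in N is zero and the congruence by 1 + N fixes E:
  -- the coupling between copies survives elimination unchanged.
  have hNE : N * E = 0 := by
    ext v w
    rw [hE, Matrix.mul_apply]
    refine Finset.sum_eq_zero fun u _ => ?_
    rw [Matrix.single_apply]
    split_ifs with h
    · rw [← h.1, hN v root (by omega), zero_mul]
    · exact mul_zero _
  have hEN : E * N.transpose = 0 := by
    rw [← Matrix.transpose_transpose E, ← Matrix.transpose_mul, hE, Matrix.transpose_single, ← hE,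
      hNE, Matrix.transpose_zero]
  have hUE : (1 + N) * E * (1 + N).transpose = E := by
    rw [add_mul, hNE, one_mul, add_zero, Matrix.transpose_add, Matrix.transpose_one, mul_add,
      hEN, mul_one, add_zero]
  have hfac : Matrix.scalar (V × W) x - alphaMatrix α (copiesGraph R H root) =
      ((1 : Matrix V V ℝ) ⊗ₖ (1 + N)) *
        ((1 : Matrix V V ℝ) ⊗ₖ Matrix.diagonal Δ - C ⊗ₖ E) *
          ((1 : Matrix V V ℝ) ⊗ₖ (1 + N).transpose) := by
    rw [mul_sub, sub_mul, ← Matrix.mul_kronecker_mul, ← Matrix.mul_kronecker_mul,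
      ← Matrix.mul_kronecker_mul, ← Matrix.mul_kronecker_mul, hUE, ← hH,
      alphaMatrix_copiesGraph]
    simp only [one_mul, mul_one]
    rw [← sub_sub]
    congr 1
    ext ⟨i, v⟩ ⟨j, w⟩
    by_cases hij : i = j <;> by_cases hvw : v = w <;>
      simp [hij, hvw]
  -- After elimination the matrix splits over W: scalar blocks away from the root, and Δ root - C at
  -- the root.
  have hblock : (1 : Matrix V V ℝ) ⊗ₖ Matrix.diagonal Δ - C ⊗ₖ E =
      Matrix.blockDiagonal fun w => Matrix.scalar V (Δ w) - if w = root then C else 0 := by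
    ext ⟨i, v⟩ ⟨j, w⟩
    rw [Matrix.blockDiagonal_apply]
    by_cases hvw : v = w
    · subst hvw
      by_cases hv : v = root
      · simp [Matrix.diagonal_apply, Matrix.one_apply, hv, hE]
      · simp [Matrix.diagonal_apply, Matrix.one_apply, hv, hE, eq_comm (a := root)]
    · have : ¬ (root = v ∧ root = w) := fun h => hvw (h.1.symm.trans h.2)
      simp [hvw, hE, this]
  have hU : (1 + N).det = 1 := Matrix.det_one_add_of_strict b N hN
  rw [hfac, Matrix.det_mul, Matrix.det_mul, Matrix.det_kronecker, Matrix.det_kronecker,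
    Matrix.det_transpose, hU, hblock, Matrix.det_blockDiagonal,
    ← Finset.prod_erase_mul _ _ (Finset.mem_univ root)]
  simp only [Matrix.det_one, one_pow, one_mul, mul_one, if_true]
  congr 1
  refine Finset.prod_congr rfl fun w hw => ?_
  rw [if_neg (Finset.ne_of_mem_erase hw), sub_zero]
  simp

/-! ### The cycle, diagonalized by the discrete Fourier matrix. -/

theorem det_scalar_sub_alphaMatrix_cycleGraph (α y : ℝ) (r : ℕ) (hr : 3 ≤ r) :
    (Matrix.scalar (Fin r) y - alphaMatrix α (SimpleGraph.cycleGraph r)).det =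
      ∏ i ∈ Finset.Icc 1 r, (y - cycleRho α r i) := by
  obtain ⟨n, rfl⟩ : ∃ n, r = n + 3 := ⟨r - 3, by omega⟩
  set θ : ℂ := 2 * Real.pi * Complex.I / ((n + 3 : ℕ) : ℂ) with hθ
  set ζ : ℂ := Complex.exp θ with hζdef
  have hζ : IsPrimitiveRoot ζ (n + 3) := Complex.isPrimitiveRoot_exp (n + 3) (by omega)
  -- The columns of F are the characters a ↦ ζ^(ab), eigenvectors of the cycle; distinct nodes make
  -- the Vandermonde determinant nonzero.
  let F : Matrix (Fin (n + 3)) (Fin (n + 3)) ℂ := Matrix.vandermonde fun a => ζ ^ (a : ℕ)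
  have hF : F.det ≠ 0 := Matrix.det_vandermonde_ne_zero_iff.2 fun a b h =>
    Fin.ext (hζ.pow_inj a.2 b.2 h)
  have hsucc : ∀ a : Fin (n + 3), ζ ^ ((a + 1 : Fin (n + 3)) : ℕ) = ζ ^ (a : ℕ) * ζ := by
    intro a
    have h := pow_mod_orderOf ζ (a + 1)
    rwa [← hζ.eq_orderOf, pow_succ] at h
  have hζ0 : ζ ≠ 0 := Complex.exp_ne_zero _
  have hpred : ∀ a : Fin (n + 3), ζ ^ ((a - 1 : Fin (n + 3)) : ℕ) = ζ ^ (a : ℕ) * ζ⁻¹ := by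
    intro a
    rw [eq_mul_inv_iff_mul_eq₀ hζ0, ← hsucc, sub_add_cancel]
  let M : Matrix (Fin (n + 3)) (Fin (n + 3)) ℝ := alphaMatrix α (SimpleGraph.cycleGraph (n + 3))
  let ev : Fin (n + 3) → ℝ := fun b => cycleRho α (n + 3) (b + 1)
  have hev : ∀ b : Fin (n + 3), (ev b : ℂ) =
      2 * α + (1 - α) * ((ζ⁻¹) ^ (b : ℕ) + ζ ^ (b : ℕ)) := by
    intro b
    have hcos : (ζ⁻¹) ^ (b : ℕ) + ζ ^ (b : ℕ) =
        2 * Complex.cos (2 * Real.pi * (b : ℕ) / ((n + 3 : ℕ) : ℂ)) := by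
      rw [Complex.two_cos, hζdef, ← Complex.exp_neg, ← Complex.exp_nat_mul,
        ← Complex.exp_nat_mul, add_comm, hθ]
      congr 2 <;> ring
    simp only [ev, cycleRho]
    rw [hcos]
    push_cast
    ring_nf
  have hMF : M.map Complex.ofRealHom * F =
      F * Matrix.diagonal fun b => (ev b : ℂ) := by
    have hM : M.map Complex.ofRealHom = (2 * α : ℂ) • (1 : Matrix (Fin (n + 3)) (Fin (n + 3)) ℂ) +
        (1 - α : ℂ) • (SimpleGraph.cycleGraph (n + 3)).adjMatrix ℂ := by
      ext a b
      simp only [M, alphaMatrix, SimpleGraph.degMatrix, Matrix.map_apply, Matrix.add_apply,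
        Matrix.smul_apply, Matrix.diagonal_apply, SimpleGraph.adjMatrix_apply,
        SimpleGraph.cycleGraph_degree_three_le, Matrix.one_apply, smul_eq_mul]
      split_ifs <;> simp <;> ring
    rw [hM]
    ext a b
    rw [add_mul, Matrix.add_apply, Matrix.smul_mul, Matrix.smul_mul, Matrix.smul_apply,
      Matrix.smul_apply, one_mul, SimpleGraph.adjMatrix_mul_apply,
      SimpleGraph.cycleGraph_neighborFinset, Finset.sum_pair, Matrix.mul_diagonal, hev]
    · simp only [F, Matrix.vandermonde_apply, hsucc, hpred, mul_pow, smul_eq_mul]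
      ring
    -- The two neighbours a - 1 and a + 1 are distinct because the cycle has at least three
    -- vertices.
    · intro h
      have h3 : a - 1 + 1 + 1 = a - 1 := by rw [sub_add_cancel, ← h]
      have h4 : (1 + 1 : Fin (n + 3)) = 0 :=
        add_left_cancel (a := a - 1) (by rw [← add_assoc, add_zero]; exact h3)
      have h5 := congrArg Fin.val h4
      rw [Fin.val_add, Fin.val_one, Fin.val_zero, Nat.mod_eq_of_lt (by omega)] at h5
      omega
  have hcomm : (Matrix.scalar (Fin (n + 3)) y - M).map Complex.ofRealHom * F =
      F * Matrix.diagonal fun b => ((y - ev b : ℝ) : ℂ) := by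
    have h1 : (Matrix.scalar (Fin (n + 3)) y - M).map Complex.ofRealHom =
        (y : ℂ) • (1 : Matrix (Fin (n + 3)) (Fin (n + 3)) ℂ) - M.map Complex.ofRealHom := by
      ext a b
      by_cases h : a = b <;> simp [h]
    have h2 : (Matrix.diagonal fun b => ((y - ev b : ℝ) : ℂ)) =
        (y : ℂ) • (1 : Matrix (Fin (n + 3)) (Fin (n + 3)) ℂ) -
          Matrix.diagonal fun b => (ev b : ℂ) := by
      ext a b
      by_cases h : a = b <;> simp [h]
    rw [h1, h2, sub_mul, hMF, mul_sub]
    simp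
  have hdet := congrArg Matrix.det hcomm
  rw [Matrix.det_mul, Matrix.det_mul, mul_comm F.det, Matrix.det_diagonal] at hdet
  have hdet' := mul_right_cancel₀ hF hdet
  rw [← RingHom.mapMatrix_apply, ← RingHom.map_det, ← Complex.ofReal_prod] at hdet'
  have hfin : (Matrix.scalar (Fin (n + 3)) y - M).det = ∏ b, (y - ev b) :=
    Complex.ofReal_injective hdet'
  have hIcc : Finset.Icc 1 (n + 3) = Finset.Ico 1 (n + 3 + 1) := by
    ext i
    simp only [Finset.mem_Icc, Finset.mem_Ico]
    omega
  rw [hfin, hIcc, Finset.prod_Ico_eq_prod_range, Nat.add_sub_cancel,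
    ← Fin.prod_univ_eq_prod_range (fun i => y - cycleRho α (n + 3) (1 + i))]
  simp only [ev, add_comm 1]

/-! ### Characteristic polynomials of T_j and S_i as products of pivots. -/

theorem betheT_eq_jacobiMatrix (α : ℝ) (d k j : ℕ) :
    betheT α d k j = jacobiMatrix (fun a => betheEntry α d k a a) ((1 - α) * √(d : ℝ)) j := by
  ext a b
  simp only [betheT, jacobiMatrix, Matrix.of_apply]
  by_cases h : (a : ℕ) = b
  · rw [if_pos h, h]
  · rw [if_neg h, betheEntry, if_neg h]

theorem betheS_eq_jacobiMatrix (α : ℝ) (d k : ℕ) (ρ : ℝ) :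
    betheS α d k ρ =
      jacobiMatrix (fun a => betheEntry α d k a a + if a + 1 = k then ρ else 0)
        ((1 - α) * √(d : ℝ)) k := by
  ext a b
  simp only [betheS, jacobiMatrix, Matrix.of_apply]
  by_cases h : (a : ℕ) = b
  · simp [h]
  · have h' : ¬ ((a : ℕ) + 1 = k ∧ (b : ℕ) + 1 = k) := by omega
    rw [if_neg h, if_neg h', betheEntry, if_neg h, add_zero]

/-- The pivots of the elimination of `x - T_k`. -/
noncomputable def bethePivot (α : ℝ) (d k : ℕ) (x : ℝ) : ℕ → ℝ
  | 0 => x - betheEntry α d k 0 0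
  | a + 1 => x - betheEntry α d k (a + 1) (a + 1) - d * (1 - α) ^ 2 / bethePivot α d k x a

theorem betheEntry_self_le {α : ℝ} (hα0 : 0 ≤ α) (d k a : ℕ) :
    betheEntry α d k a a ≤ α * (d + 1) := by
  have hd : (0 : ℝ) ≤ α * d := by positivity
  rw [betheEntry, if_pos rfl]
  split_ifs <;> linarith

/-- Beyond this threshold all pivots stay at least 1, so elimination never divides by zero;
infinitely many such x suffice to identify polynomials. -/
theorem one_le_bethePivot {α : ℝ} (hα0 : 0 ≤ α) (d k : ℕ) {x : ℝ}
    (hx : α * (d + 1) + d * (1 - α) ^ 2 + 1 ≤ x) (a : ℕ) : 1 ≤ bethePivot α d k x a := by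
  have hd : (0 : ℝ) ≤ d * (1 - α) ^ 2 := by positivity
  induction a with
  | zero =>
    have := betheEntry_self_le hα0 d k 0
    rw [bethePivot]
    linarith
  | succ a ih =>
    have h1 := betheEntry_self_le hα0 d k (a + 1)
    have h2 : d * (1 - α) ^ 2 / bethePivot α d k x a ≤ d * (1 - α) ^ 2 := div_le_self hd ih
    rw [bethePivot]
    linarith

theorem eval_charpoly_betheT {α : ℝ} (hα0 : 0 ≤ α) (d k j : ℕ) {x : ℝ}
    (hx : α * (d + 1) + d * (1 - α) ^ 2 + 1 ≤ x) :
    (betheT α d k j).charpoly.eval x = ∏ a ∈ Finset.range j, bethePivot α d k x a := by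
  rw [Matrix.eval_charpoly, betheT_eq_jacobiMatrix,
    jacobiMatrix.det_scalar_sub (g := bethePivot α d k x) x, Fin.prod_univ_eq_prod_range]
  · rfl
  intro a _
  refine ⟨(zero_lt_one.trans_le (one_le_bethePivot hα0 d k hx a)).ne', ?_⟩
  rw [mul_pow, Real.sq_sqrt (Nat.cast_nonneg d), mul_comm _ (d : ℝ), bethePivot]

theorem eval_charpoly_betheS {α : ℝ} (hα0 : 0 ≤ α) (d m : ℕ) (ρ : ℝ) {x : ℝ}
    (hx : α * (d + 1) + d * (1 - α) ^ 2 + 1 ≤ x) :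
    (betheS α d (m + 1) ρ).charpoly.eval x =
      (∏ a ∈ Finset.range m, bethePivot α d (m + 1) x a) * (bethePivot α d (m + 1) x m - ρ) := by
  -- The added ρ changes only the last pivot, which feeds no later one.
  let g : ℕ → ℝ := fun a => bethePivot α d (m + 1) x a - if a + 1 = m + 1 then ρ else 0
  have hlt : ∀ a, a ≠ m → g a = bethePivot α d (m + 1) x a := fun a ha => by simp [g, ha]
  rw [Matrix.eval_charpoly, betheS_eq_jacobiMatrix,
    jacobiMatrix.det_scalar_sub (g := g) x, Fin.prod_univ_eq_prod_range, Finset.prod_range_succ]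
  · congr 1
    · exact Finset.prod_congr rfl fun a ha => hlt a (Finset.mem_range.1 ha).ne
    · simp [g]
  · simp only [g, bethePivot]
    ring
  · intro a ha
    rw [hlt a (by omega)]
    refine ⟨(zero_lt_one.trans_le (one_le_bethePivot hα0 d _ hx a)).ne', ?_⟩
    simp only [g, bethePivot]
    rw [mul_pow, Real.sq_sqrt (Nat.cast_nonneg d), mul_comm _ (d : ℝ)]
    ring

/-! ### Matching exponents and the characteristic polynomial identity. -/

/-- A telescoping geometric sum of exponents. Passing from m to m + 1 raises the earlier factors to
the power d, and the new prefix, with exponent d - 1, joins the unpaired prefix to give exponent d.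
-/
theorem prod_prefix_prod_pow {M : Type*} [CommMonoid M] (g : ℕ → M) {d : ℕ} (hd : 1 ≤ d) (m : ℕ) :
    (∏ j ∈ Finset.Ico 1 (m + 1), (∏ a ∈ Finset.range j, g a) ^ (d ^ (m - j) * (d - 1))) *
      ∏ a ∈ Finset.range m, g a = ∏ a ∈ Finset.range m, g a ^ d ^ (m - a) := by
  induction m with
  | zero => simp
  | succ m ih =>
    have h1 : ∏ j ∈ Finset.Ico 1 (m + 1),
        (∏ a ∈ Finset.range j, g a) ^ (d ^ (m + 1 - j) * (d - 1)) =
        (∏ j ∈ Finset.Ico 1 (m + 1),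
          (∏ a ∈ Finset.range j, g a) ^ (d ^ (m - j) * (d - 1))) ^ d := by
      rw [← Finset.prod_pow]
      refine Finset.prod_congr rfl fun j hj => ?_
      rw [← pow_mul, Nat.succ_sub (Nat.lt_succ_iff.1 (Finset.mem_Ico.1 hj).2), pow_succ]
      congr 1
      ring
    have h2 : ∏ a ∈ Finset.range m, g a ^ d ^ (m + 1 - a) =
        (∏ a ∈ Finset.range m, g a ^ d ^ (m - a)) ^ d := by
      rw [← Finset.prod_pow]
      refine Finset.prod_congr rfl fun a ha => ?_
      rw [← pow_mul, Nat.succ_sub (Finset.mem_range.1 ha).le, pow_succ]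
    rw [Finset.prod_Ico_succ_top (by omega), h1, Nat.sub_self, pow_zero, one_mul,
      Finset.prod_range_succ (fun a => g a ^ d ^ (m + 1 - a)), h2, ← ih, Finset.prod_range_succ,
      Nat.add_sub_cancel_left, pow_one, mul_assoc, ← pow_succ, Nat.sub_add_cancel hd, mul_pow,
      mul_pow, mul_assoc]

theorem IsBetheTree.charpoly_eq {W : Type*} [Fintype W] [DecidableEq W] {H : SimpleGraph W}
    [DecidableRel H.Adj] {root : W} {d k r : ℕ} (hd : 1 ≤ d) (hk : 2 ≤ k) (hr : 3 ≤ r)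
    (hH : IsBetheTree H root d k) {α : ℝ} (hα0 : 0 ≤ α) :
    (alphaMatrix α (copiesGraph (SimpleGraph.cycleGraph r) H root)).charpoly =
      (∏ j ∈ Finset.Icc 1 (k - 1), (betheT α d k j).charpoly ^ (r * d ^ (k - j - 1) * (d - 1))) *
        ∏ i ∈ Finset.Icc 1 r, (betheS α d k (cycleRho α r i)).charpoly := by
  refine Polynomial.eq_of_infinite_eval_eq _ _
    ((Set.Ici_infinite (α * (d + 1) + d * (1 - α) ^ 2 + 1)).mono fun x hx => ?_)
  have hx' : α * (d + 1) + d * (1 - α) ^ 2 + 1 ≤ x := hx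
  obtain ⟨m, rfl⟩ : ∃ m, k = m + 1 := ⟨k - 1, by omega⟩
  set g := bethePivot α d (m + 1) x with hg
  obtain ⟨N, hN, hfac⟩ := hH.exists_factorization hk α x (g := g) rfl fun a _ =>
    ⟨(zero_lt_one.trans_le (one_le_bethePivot hα0 d _ hx' a)).ne', rfl⟩
  have hdet := det_scalar_sub_alphaMatrix_copiesGraph α x (SimpleGraph.cycleGraph r) H root
    (H.dist root) SimpleGraph.dist_self N _ hN hfac
  rw [Set.mem_ofPred_eq, Matrix.eval_charpoly, hdet, SimpleGraph.dist_self,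
    det_scalar_sub_alphaMatrix_cycleGraph _ _ _ hr, Polynomial.eval_mul, Polynomial.eval_prod,
    Polynomial.eval_prod]
  simp only [Polynomial.eval_pow, eval_charpoly_betheT hα0 _ _ _ hx',
    eval_charpoly_betheS hα0 _ m _ hx', Finset.prod_mul_distrib, Finset.prod_const,
    Nat.card_Icc, Nat.add_sub_cancel, Nat.sub_zero, Fintype.card_fin, ← hg]
  rw [← mul_assoc]
  congr 1
  rw [Finset.prod_pow, hH.prod_dist hk fun l => g (m - l)]
  -- Pass from distance l to the root to pivot index a = m - l.
  have h1 : ∏ l ∈ Finset.Ico 1 (m + 1), g (m - l) ^ d ^ l =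
      ∏ a ∈ Finset.range m, g a ^ d ^ (m - a) := by
    rw [Finset.prod_Ico_eq_prod_range, Nat.add_sub_cancel, ← Finset.prod_range_reflect]
    refine Finset.prod_congr rfl fun a ha => ?_
    have := Finset.mem_range.1 ha
    rw [show m - (1 + (m - 1 - a)) = a by omega, show 1 + (m - 1 - a) = m - a by omega]
  rw [h1, ← prod_prefix_prod_pow g hd, mul_pow, ← Finset.prod_pow]
  congr 1
  refine Finset.prod_congr (by ext; simp only [Finset.mem_Ico, Finset.mem_Icc]; omega)
    fun j _ => ?_
  rw [← pow_mul, show m + 1 - j - 1 = m - j by omega]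
  congr 1
  ring

theorem mem_specMultiset {n : Type*} [Fintype n] [DecidableEq n] {M : Matrix n n ℝ} {μ : ℝ} :
    μ ∈ specMultiset M ↔ μ ∈ spectrum ℝ M := by
  rw [specMultiset, Polynomial.mem_roots M.charpoly_monic.ne_zero,
    Matrix.mem_spectrum_iff_isRoot_charpoly]

theorem count_specMultiset_of_nodup {n : Type*} [Fintype n] [DecidableEq n] {M : Matrix n n ℝ}
    (h : (specMultiset M).Nodup) (μ : ℝ) :
    (specMultiset M).count μ = Set.indicator (spectrum ℝ M) (fun _ => (1 : ℕ)) μ := by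
  classical
  rw [Multiset.count_eq_of_nodup h, Set.indicator_apply]
  simp only [mem_specMultiset]

theorem isHermitian_alphaMatrix {V : Type*} [Fintype V] [DecidableEq V] (α : ℝ)
    (G : SimpleGraph V) [DecidableRel G.Adj] : (alphaMatrix α G).IsHermitian := by
  ext v w
  by_cases h : v = w
  · simp [h]
  · simp [alphaMatrix, SimpleGraph.degMatrix, h, Ne.symm h, G.adj_comm]

theorem IsBetheTree.specMultiset_eq {W : Type*} [Fintype W] [DecidableEq W] {H : SimpleGraph W}
    [DecidableRel H.Adj] {root : W} {d k r : ℕ} (hd : 1 ≤ d) (hk : 2 ≤ k) (hr : 3 ≤ r)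
    (hH : IsBetheTree H root d k) {α : ℝ} (hα0 : 0 ≤ α) :
    specMultiset (alphaMatrix α (copiesGraph (SimpleGraph.cycleGraph r) H root)) =
      ∑ j ∈ Finset.Icc 1 (k - 1), (r * d ^ (k - j - 1) * (d - 1)) • specMultiset (betheT α d k j) +
        ∑ i ∈ Finset.Icc 1 r, specMultiset (betheS α d k (cycleRho α r i)) := by
  have h1 : (∏ j ∈ Finset.Icc 1 (k - 1),
      (betheT α d k j).charpoly ^ (r * d ^ (k - j - 1) * (d - 1))).Monic :=
    Polynomial.monic_prod_of_monic _ _ fun j _ => (Matrix.charpoly_monic _).pow _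
  have h2 : (∏ i ∈ Finset.Icc 1 r, (betheS α d k (cycleRho α r i)).charpoly).Monic :=
    Polynomial.monic_prod_of_monic _ _ fun i _ => Matrix.charpoly_monic _
  rw [specMultiset, hH.charpoly_eq hd hk hr hα0, Polynomial.roots_mul (h1.mul h2).ne_zero,
    Polynomial.roots_prod _ _ h1.ne_zero, Polynomial.roots_prod _ _ h2.ne_zero]
  simp only [Polynomial.roots_pow]
  rfl

/-! ### Perron bound and the main theorem. -/

theorem betheEntry_nonneg {α : ℝ} (hα0 : 0 ≤ α) (hα1 : α < 1) (d k a b : ℕ) :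
    0 ≤ betheEntry α d k a b := by
  have h : 0 ≤ (1 - α) * √(d : ℝ) := mul_nonneg (by linarith) (Real.sqrt_nonneg _)
  rw [betheEntry]
  split_ifs <;> positivity

theorem abs_cycleRho_le {α : ℝ} (hα0 : 0 ≤ α) (hα1 : α < 1) (r i : ℕ) :
    |cycleRho α r i| ≤ 2 := by
  have h1 := Real.neg_one_le_cos (2 * Real.pi * ((i : ℝ) - 1) / r)
  have h2 := Real.cos_le_one (2 * Real.pi * ((i : ℝ) - 1) / r)
  rw [cycleRho, abs_le]
  constructor <;> nlinarith

theorem cycleRho_one (α : ℝ) (r : ℕ) : cycleRho α r 1 = 2 := by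
  simp [cycleRho]
  ring

/-- `S_1` has a positive eigenvector, and its eigenvalue bounds all eigenvalues of the matrices
`T_j` and `S_i`. -/
theorem exists_perron_betheS {d k : ℕ} (hd : 1 ≤ d) (hk : 2 ≤ k) {α : ℝ} (hα0 : 0 ≤ α)
    (hα1 : α < 1) : ∃ lam ∈ spectrum ℝ (betheS α d k 2),
      (∀ j ≤ k, ∀ μ ∈ spectrum ℝ (betheT α d k j), |μ| ≤ lam) ∧
      ∀ ρ : ℝ, |ρ| ≤ 2 → ∀ μ ∈ spectrum ℝ (betheS α d k ρ), |μ| ≤ lam := by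
  obtain ⟨m, rfl⟩ : ∃ m, k = m + 1 := ⟨k - 1, by omega⟩
  have he : 0 < (1 - α) * √(d : ℝ) :=
    mul_pos (by linarith) (Real.sqrt_pos.2 (Nat.cast_pos.2 hd))
  have hB := betheEntry_nonneg hα0 hα1 d (m + 1)
  have hS0 : ∀ a b, 0 ≤ betheS α d (m + 1) 2 a b := fun a b => by
    simp only [betheS, Matrix.of_apply]
    exact add_nonneg (hB _ _) (by split_ifs <;> norm_num)
  have hherm : (betheS α d (m + 1) 2).IsHermitian := by
    rw [betheS_eq_jacobiMatrix]
    exact jacobiMatrix.isHermitian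
  obtain ⟨lam, hlam, u, hu, hu0, hSu⟩ := hherm.exists_nonneg_eigenvector hS0
  have hpos : ∀ a, 0 < u a := by
    rw [betheS_eq_jacobiMatrix] at hSu
    refine jacobiMatrix.pos_of_nonneg he (fun a => ?_) hSu hu0 hu
    exact add_nonneg (hB _ _) (by split_ifs <;> norm_num)
  refine ⟨lam, hlam, fun j hj μ hμ => ?_, fun ρ hρ μ hμ => ?_⟩
  · obtain ⟨z, hz, hTz⟩ := Matrix.exists_mulVec_eq_smul_of_mem_spectrum hμ
    -- T_j is a leading principal submatrix of T_k, which lies entrywise below S_1.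
    refine Matrix.abs_eigenvalue_le (Fin.castLEEmb hj) (fun a b => ?_) hS0 hpos hSu hz hTz
    simp only [betheT, betheS, Matrix.of_apply, Fin.castLEEmb_apply, Fin.val_castLE]
    rw [abs_of_nonneg (hB _ _)]
    exact le_add_of_nonneg_right (by split_ifs <;> norm_num)
  · obtain ⟨z, hz, hTz⟩ := Matrix.exists_mulVec_eq_smul_of_mem_spectrum hμ
    refine Matrix.abs_eigenvalue_le (Function.Embedding.refl _) (fun a b => ?_) hS0 hpos hSu hz hTz
    simp only [betheS, Matrix.of_apply, Function.Embedding.refl_apply]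
    refine (abs_add_le _ _).trans (add_le_add (abs_of_nonneg (hB _ _)).le ?_)
    split_ifs
    · exact hρ
    · simp

theorem mainTheorem6 {W : Type*} [Fintype W] [DecidableEq W] (H : SimpleGraph W)
    [DecidableRel H.Adj] (root : W) (d k r : ℕ) (hd : 1 ≤ d) (hk : 2 ≤ k) (hr : 3 ≤ r)
    (hH : IsBetheTree H root d k) (α : ℝ) (hα0 : 0 ≤ α) (hα1 : α < 1)
    (A : Matrix (Fin r × W) (Fin r × W) ℝ)
    (hA : A = alphaMatrix α (copiesGraph (SimpleGraph.cycleGraph r) H root)) :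
    -- (1) the spectrum as a multiset, and as a set
    (specMultiset A =
      ∑ j ∈ Finset.Icc 1 (k - 1), (r * d ^ (k - j - 1) * (d - 1)) • specMultiset (betheT α d k j) +
        ∑ i ∈ Finset.Icc 1 r, specMultiset (betheS α d k (cycleRho α r i))) ∧
    (2 ≤ d → spectrum ℝ A =
      (⋃ j ∈ Finset.Icc 1 (k - 1), spectrum ℝ (betheT α d k j)) ∪
        ⋃ i ∈ Finset.Icc 1 r, spectrum ℝ (betheS α d k (cycleRho α r i))) ∧
    -- (2) the eigenvalues of every `T_j` and of every `S_i` are simple; an eigenvalue of `T_j`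
    -- contributes `r d ^ (k - j - 1) (d - 1)` and one of `S_i` contributes `1` to the multiplicity
    (∀ j ∈ Finset.Icc 1 (k - 1), (specMultiset (betheT α d k j)).Nodup) ∧
    (∀ i ∈ Finset.Icc 1 r, (specMultiset (betheS α d k (cycleRho α r i))).Nodup) ∧
    (∀ μ : ℝ, Module.finrank ℝ (Module.End.eigenspace (Matrix.toLin' A) μ) =
      ∑ j ∈ Finset.Icc 1 (k - 1), (r * d ^ (k - j - 1) * (d - 1)) *
          Set.indicator (spectrum ℝ (betheT α d k j)) (fun _ => (1 : ℕ)) μ +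
        ∑ i ∈ Finset.Icc 1 r,
          Set.indicator (spectrum ℝ (betheS α d k (cycleRho α r i))) (fun _ => (1 : ℕ)) μ) ∧
    -- (3) the spectral radius
    (∃ ρ : NNReal, IsGreatest (spectrum ℝ (betheS α d k 2)) (ρ : ℝ) ∧
      spectralRadius ℝ A = (ρ : ENNReal)) := by
  subst hA
  have he : (1 - α) * √(d : ℝ) ≠ 0 :=
    (mul_pos (by linarith) (Real.sqrt_pos.2 (Nat.cast_pos.2 hd))).ne'
  have hspec := hH.specMultiset_eq hd hk hr hα0
  have hT : ∀ j, (specMultiset (betheT α d k j)).Nodup := fun j => by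
    rw [betheT_eq_jacobiMatrix]
    exact jacobiMatrix.nodup_roots_charpoly he
  have hS : ∀ ρ, (specMultiset (betheS α d k ρ)).Nodup := fun ρ => by
    rw [betheS_eq_jacobiMatrix]
    exact jacobiMatrix.nodup_roots_charpoly he
  -- The condition that the coefficient be nonzero matters: for d = 1 every T_j drops out, which is
  -- why the set identity needs d ≥ 2.
  have hmem : ∀ μ, μ ∈ spectrum ℝ
      (alphaMatrix α (copiesGraph (SimpleGraph.cycleGraph r) H root)) ↔
      (∃ j ∈ Finset.Icc 1 (k - 1), r * d ^ (k - j - 1) * (d - 1) ≠ 0 ∧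
        μ ∈ spectrum ℝ (betheT α d k j)) ∨
      ∃ i ∈ Finset.Icc 1 r, μ ∈ spectrum ℝ (betheS α d k (cycleRho α r i)) := by
    intro μ
    rw [← mem_specMultiset, hspec, Multiset.mem_add, Multiset.mem_sum, Multiset.mem_sum]
    simp only [Multiset.mem_nsmul, mem_specMultiset]
  refine ⟨hspec, fun hd2 => ?_, fun j _ => hT j, fun i _ => hS _, fun μ => ?_, ?_⟩
  · ext μ
    have hne : ∀ j, r * d ^ (k - j - 1) * (d - 1) ≠ 0 := fun j =>
      mul_ne_zero (mul_ne_zero (by omega) (pow_ne_zero _ (by omega))) (by omega)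
    simp only [hmem, hne, Set.mem_union, Set.mem_iUnion, exists_prop, ne_eq, not_false_eq_true,
      true_and]
  · rw [(isHermitian_alphaMatrix α _).finrank_eigenspace_eq_count μ]
    change (specMultiset _).count μ = _
    rw [hspec, Multiset.count_add, Multiset.count_sum', Multiset.count_sum']
    simp only [Multiset.count_nsmul, count_specMultiset_of_nodup (hT _),
      count_specMultiset_of_nodup (hS _)]
  · obtain ⟨lam, hlam, hleT, hleS⟩ := exists_perron_betheS hd hk hα0 hα1
    have hle2 := hleS 2 (by norm_num)
    have hlam0 : 0 ≤ lam := (abs_nonneg _).trans (hle2 lam hlam)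
    -- The supremum is attained at lam itself, an eigenvalue of A through i = 1, where the cosine is
    -- 1 and `cycleRho` equals 2.
    refine ⟨⟨lam, hlam0⟩, ⟨hlam, fun μ hμ => (le_abs_self μ).trans (hle2 μ hμ)⟩,
      le_antisymm (iSup₂_le fun μ hμ => ?_) (le_iSup₂_of_le lam ((hmem lam).2 (Or.inr
        ⟨1, Finset.mem_Icc.2 ⟨le_rfl, by omega⟩, by rwa [cycleRho_one]⟩)) ?_)⟩
    · have hμ' : |μ| ≤ lam := by
        rcases (hmem μ).1 hμ with ⟨j, hj, -, h⟩ | ⟨i, -, h⟩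
        · exact hleT j (by have := (Finset.mem_Icc.1 hj).2; omega) μ h
        · exact hleS _ (abs_cycleRho_le hα0 hα1 r i) μ h
      exact ENNReal.coe_le_coe.2 (NNReal.coe_le_coe.1 hμ')
    · exact ENNReal.coe_le_coe.2 (NNReal.coe_le_coe.1 (le_abs_self lam))
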